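/- Consider the Cauchy problem for the one-dimensional defocusing cubic wave equation $$u_{tt}-u_{xx}+u^3=0,\qquad u(0,x)=u_0(x),\quad u_t(0,x)=u_1(x),\qquad x\in\mathbb R .$$ For every $M$ there is a constant $C$, depending only on $M$, with the following property. Let $u_0\in C^1(\mathbb R)$ and $u_1\in C^0(\mathbb R)$ be real-valued with $|u_0(x)|\le M$, $|u_0'(x)|\le M$ and $|u_1(x)|\le M$ for all $x\in\mathbb R$, and let $u:[0,\infty)\times\mathbb R\to\mathbb R$ be a continuous weak solution of the Cauchy problem, that is, $$\int_0^\infty\!\!\int_{\mathbb R}\bigl(u\,(\varphi_{tt}-\varphi_{xx})+u^3\varphi\bigr)\,dx\,dt=\int_{\mathbb R}\bigl(u_1(x)\varphi(0,x)-u_0(x)\varphi_t(0,x)\bigr)\,dx\qquad\text{for all }\varphi\in C_c^\infty(\mathbb R^2).$$ Then, for all $x\in\mathbb R$, $$|u(t,x)|\le C\,t^{1/3}\quad\text{for all }t\ge 1,\qquad\text{and}\qquad |u(t,x)|\le C\quad\text{for all }0\le t\le 1 .$$ -/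

import Mathlib

open Set MeasureTheory
open scoped ContDiff

/-- `u` is a (continuous, weak) solution on `[0, ∞) × ℝ` of the Cauchy problem
`u_tt - u_xx + u³ = 0`, `u(0, x) = u₀(x)`, `u_t(0, x) = u₁(x)`.

For data in `C¹ × C⁰` the second derivatives of a solution need not exist, so the equation is meant
in the sense of distributions. The initial conditions appear through the boundary terms at `t = 0`
that two integrations by parts in time produce; test functions need not vanish there. Only the
values `u t x` with `t ≥ 0` matter. -/
structure IsCubicWaveSolution (u₀ u₁ : ℝ → ℝ) (u : ℝ → ℝ → ℝ) : Prop where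
  continuousOn : ContinuousOn (fun p : ℝ × ℝ => u p.1 p.2) (Ici 0 ×ˢ univ)
  weak_eq : ∀ φ : ℝ × ℝ → ℝ, ContDiff ℝ ∞ φ → HasCompactSupport φ →
    ∫ p in (Ioi (0 : ℝ)) ×ˢ (univ : Set ℝ),
        (u p.1 p.2 * (iteratedDeriv 2 (fun t => φ (t, p.2)) p.1
            - iteratedDeriv 2 (fun x => φ (p.1, x)) p.2)
          + u p.1 p.2 ^ 3 * φ p)
      = ∫ x : ℝ, (u₁ x * φ (0, x) - u₀ x * deriv (fun t => φ (t, x)) 0)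

/-! In the null coordinates `a = t + x`, `b = t - x` the equation reads `4 v_ab = -v³`. Hence `∂_b
(v_a²) = -v_a v³ / 2`, while `∂_a (v⁴ / 4) = v_a v³`. Integrating `v_a v³` over a backward light
triangle in both orders shows that the flux of `v_a²` through one characteristic side plus the flux
of `v⁴ / 8` through the other equals its value on the initial line (`IsNullSolution.energy_eq`). For
bounded data that value is `O(t)`.

Exchanging `a` and `b` gives the mirror identity, so on one and the same side both `∫ v_a²` and `∫
v⁴` are `O(t)`. Along this side `(v³)_a = 3 v² v_a`, which is at most `(3 / 2) (v⁴ + v_a²)` in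
absolute value. Hence `|v|³` at the apex is at most `M³ + O(t)` (`IsNullSolution.abs_pow_three_le`),
which is the exponent `1 / 3`.

A weak solution has too little regularity for this computation to be immediate. Testing with
smoothed indicators of light triangles yields the integral equation (`IsCubicWaveSolution.duhamel`).
From it `v_a` exists and is differentiable in `b`, and nothing more is needed. -/

/-! ### Products of functions of the null coordinates as test functions -/

section TestFunctions

variable {P Q : ℝ → ℝ}

lemma hasDerivAt_mul_null (hP : Differentiable ℝ P) (hQ : Differentiable ℝ Q) (t x : ℝ) :
    HasDerivAt (fun s => P (s + x) * Q (s - x))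
      (deriv P (t + x) * Q (t - x) + P (t + x) * deriv Q (t - x)) t :=
  ((hP (t + x)).hasDerivAt.comp_add_const t x).mul ((hQ (t - x)).hasDerivAt.comp_sub_const t x)

lemma hasDerivAt_mul_null_space (hP : Differentiable ℝ P) (hQ : Differentiable ℝ Q) (t x : ℝ) :
    HasDerivAt (fun y => P (t + y) * Q (t - y))
      (deriv P (t + x) * Q (t - x) - P (t + x) * deriv Q (t - x)) x := by
  have h := ((hP (t + x)).hasDerivAt.comp_const_add t x).fun_mul
    ((hQ (t - x)).hasDerivAt.comp_const_sub t x)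
  exact h.congr_deriv (by ring)

lemma iteratedDeriv_two_mul_null (hP : ContDiff ℝ ∞ P) (hQ : ContDiff ℝ ∞ Q) (t x : ℝ) :
    iteratedDeriv 2 (fun s => P (s + x) * Q (s - x)) t
      - iteratedDeriv 2 (fun y => P (t + y) * Q (t - y)) x
      = 4 * deriv P (t + x) * deriv Q (t - x) := by
  have hP0 : Differentiable ℝ P := hP.differentiable (by simp)
  have hQ0 : Differentiable ℝ Q := hQ.differentiable (by simp)
  have hP1 : Differentiable ℝ (deriv P) :=
    ((contDiff_infty_iff_deriv.1 hP).2).differentiable (by simp)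
  have hQ1 : Differentiable ℝ (deriv Q) :=
    ((contDiff_infty_iff_deriv.1 hQ).2).differentiable (by simp)
  have e1 : deriv (fun s => P (s + x) * Q (s - x)) =
      fun s => deriv P (s + x) * Q (s - x) + P (s + x) * deriv Q (s - x) :=
    funext fun s => (hasDerivAt_mul_null hP0 hQ0 s x).deriv
  have e2 : deriv (fun y => P (t + y) * Q (t - y)) =
      fun y => deriv P (t + y) * Q (t - y) - P (t + y) * deriv Q (t - y) :=
    funext fun y => (hasDerivAt_mul_null_space hP0 hQ0 t y).deriv
  rw [iteratedDeriv_succ, iteratedDeriv_one, iteratedDeriv_succ, iteratedDeriv_one, e1, e2,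
    ((hasDerivAt_mul_null hP1 hQ0 t x).fun_add (hasDerivAt_mul_null hP0 hQ1 t x)).deriv,
    ((hasDerivAt_mul_null_space hP1 hQ0 t x).fun_sub (hasDerivAt_mul_null_space hP0 hQ1 t x)).deriv]
  ring

/-- The weak formulation tested with `P (t + x) * Q (t - x)`, where `P` and `Q` vanish near `+∞`.
The support of this product is only compact in the half-space `t ≥ 0`, which is enough. -/
lemma IsCubicWaveSolution.weak_eq_mul_null {u₀ u₁ : ℝ → ℝ} {u : ℝ → ℝ → ℝ}
    (hu : IsCubicWaveSolution u₀ u₁ u) (hP : ContDiff ℝ ∞ P) (hQ : ContDiff ℝ ∞ Q) {A B : ℝ}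
    (hPA : ∀ a, A ≤ a → P a = 0) (hQB : ∀ b, B ≤ b → Q b = 0) :
    ∫ p in (Ioi (0 : ℝ)) ×ˢ (univ : Set ℝ),
        (u p.1 p.2 * (4 * deriv P (p.1 + p.2) * deriv Q (p.1 - p.2))
          + u p.1 p.2 ^ 3 * (P (p.1 + p.2) * Q (p.1 - p.2)))
      = ∫ x : ℝ, (u₁ x * (P x * Q (-x))
          - u₀ x * (deriv P x * Q (-x) + P x * deriv Q (-x))) := by
  -- The cutoff vanishes for `t ≤ -2`, which makes the support compact, and equals `1` on a
  -- neighbourhood of `t ≥ 0`, so it changes neither the integrand nor the time derivative at `t =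
  -- 0`.
  have hχ : ∀ t : ℝ, -1 ≤ t → Real.smoothTransition (t + 2) = 1 := fun t ht =>
    Real.smoothTransition.one_of_one_le (by linarith)
  set φ : ℝ × ℝ → ℝ := fun p =>
    P (p.1 + p.2) * Q (p.1 - p.2) * Real.smoothTransition (p.1 + 2) with hφ
  have hsm : ContDiff ℝ ∞ φ :=
    ((hP.comp (contDiff_fst.add contDiff_snd)).mul (hQ.comp (contDiff_fst.sub contDiff_snd))).mul
      (Real.smoothTransition.contDiff.comp (contDiff_fst.add contDiff_const))
  have hcs : HasCompactSupport φ := by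
    refine HasCompactSupport.intro
      (K := Icc (-2) ((A + B) / 2) ×ˢ Icc (-2 - B) (A + 2)) (isCompact_Icc.prod isCompact_Icc) ?_
    rintro ⟨t, x⟩ h
    by_contra hne
    simp only [hφ, mul_eq_zero, not_or] at hne
    obtain ⟨⟨h1, h2⟩, h3⟩ := hne
    have h1' : t + x < A := not_le.1 fun h => h1 (hPA _ h)
    have h2' : t - x < B := not_le.1 fun h => h2 (hQB _ h)
    have h3' : -2 < t := not_le.1 fun h =>
      h3 (Real.smoothTransition.zero_of_nonpos (by linarith))
    exact h ⟨⟨by linarith, by linarith⟩, ⟨by linarith, by linarith⟩⟩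
  have hev : ∀ t x : ℝ, 0 ≤ t →
      (fun s => φ (s, x)) =ᶠ[nhds t] fun s => P (s + x) * Q (s - x) := by
    intro t x ht
    filter_upwards [lt_mem_nhds (show (-1 : ℝ) < t by linarith)] with s hs
    simp [hφ, hχ s hs.le]
  have key := hu.weak_eq φ hsm hcs
  have hL : ∀ p ∈ (Ioi (0 : ℝ)) ×ˢ (univ : Set ℝ),
      u p.1 p.2 * (iteratedDeriv 2 (fun t => φ (t, p.2)) p.1
            - iteratedDeriv 2 (fun x => φ (p.1, x)) p.2) + u p.1 p.2 ^ 3 * φ p =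
      u p.1 p.2 * (4 * deriv P (p.1 + p.2) * deriv Q (p.1 - p.2))
          + u p.1 p.2 ^ 3 * (P (p.1 + p.2) * Q (p.1 - p.2)) := by
    rintro ⟨t, x⟩ ⟨ht, -⟩
    have ht : 0 < t := ht
    have e : (fun y => φ (t, y)) = fun y => P (t + y) * Q (t - y) := by
      funext y; simp [hφ, hχ t (by linarith)]
    have e0 : φ (t, x) = P (t + x) * Q (t - x) := congrFun e x
    rw [(hev t x ht.le).iteratedDeriv_eq, e, e0, iteratedDeriv_two_mul_null hP hQ]
  have hR : ∀ x, u₁ x * φ (0, x) - u₀ x * deriv (fun t => φ (t, x)) 0 =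
      u₁ x * (P x * Q (-x)) - u₀ x * (deriv P x * Q (-x) + P x * deriv Q (-x)) := by
    intro x
    have e := (hev 0 x le_rfl).eq_of_nhds
    rw [(hev 0 x le_rfl).deriv_eq, e,
      (hasDerivAt_mul_null (hP.differentiable (by simp)) (hQ.differentiable (by simp)) 0 x).deriv]
    simp
  rw [setIntegral_congr_fun (measurableSet_Ioi.prod MeasurableSet.univ) hL] at key
  rw [key]
  exact integral_congr_ae (.of_forall hR)

end TestFunctions

/-- The change of variables `(a, b) = (t + x, t - x)`. -/
lemma integral_null_coordinates (f : ℝ × ℝ → ℝ) :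
    ∫ p : ℝ × ℝ, f (p.1 + p.2, p.1 - p.2) = (1 / 2) * ∫ q : ℝ × ℝ, f q := by
  let L : (ℝ × ℝ) →ₗ[ℝ] (ℝ × ℝ) :=
    (LinearMap.fst ℝ ℝ ℝ + LinearMap.snd ℝ ℝ ℝ).prod (LinearMap.fst ℝ ℝ ℝ - LinearMap.snd ℝ ℝ ℝ)
  have hdet : LinearMap.det L = -2 := by
    rw [← LinearMap.det_toMatrix (Module.Basis.finTwoProd ℝ), Matrix.det_fin_two]
    simp [LinearMap.toMatrix_apply, L]
    norm_num
  let e : (ℝ × ℝ) ≃L[ℝ] (ℝ × ℝ) :=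
    (LinearEquiv.ofIsUnitDet (v := Module.Basis.finTwoProd ℝ) (v' := Module.Basis.finTwoProd ℝ)
      (f := L) (by rw [LinearMap.det_toMatrix, hdet]; norm_num)).toContinuousLinearEquiv
  have h := integral_map_equiv (μ := (volume : Measure (ℝ × ℝ)))
    e.toHomeomorph.toMeasurableEquiv f
  have hm : Measure.map L (volume : Measure (ℝ × ℝ)) = ENNReal.ofReal |(-2 : ℝ)⁻¹| • volume := by
    rw [Measure.map_linearMap_addHaar_eq_smul_addHaar _ (by rw [hdet]; norm_num), hdet]
  have hm' : Measure.map e.toHomeomorph.toMeasurableEquiv (volume : Measure (ℝ × ℝ)) =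
    ENNReal.ofReal |(-2 : ℝ)⁻¹| • volume := hm
  rw [hm', integral_smul_measure] at h
  have h' : ∫ p : ℝ × ℝ, f (p.1 + p.2, p.1 - p.2) =
      (ENNReal.ofReal |(-2 : ℝ)⁻¹|).toReal • ∫ x, f x := h.symm
  rw [h', ENNReal.toReal_ofReal (abs_nonneg _), smul_eq_mul]
  norm_num

/-! ### Smooth steps and the approximate identities formed by their derivatives -/

section SmoothStep

open Filter Topology

/-- A smooth step from `0` on `(-∞, 0]` to `1` on `[1 / (n + 1), ∞)`. -/
noncomputable def smoothStep (n : ℕ) (s : ℝ) : ℝ := Real.smoothTransition ((n + 1) * s)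

lemma contDiff_smoothStep (n : ℕ) : ContDiff ℝ ∞ (smoothStep n) :=
  Real.smoothTransition.contDiff.comp (contDiff_const.mul contDiff_id)

lemma continuous_smoothStep (n : ℕ) : Continuous (smoothStep n) :=
  (contDiff_smoothStep n).continuous

lemma continuous_deriv_smoothStep (n : ℕ) : Continuous (deriv (smoothStep n)) :=
  (contDiff_smoothStep n).continuous_deriv (by simp)

lemma hasDerivAt_smoothStep (n : ℕ) (s : ℝ) :
    HasDerivAt (smoothStep n) (deriv (smoothStep n) s) s :=
  (((contDiff_smoothStep n).differentiable (by simp)) s).hasDerivAt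

lemma smoothStep_of_nonpos (n : ℕ) {s : ℝ} (hs : s ≤ 0) : smoothStep n s = 0 :=
  Real.smoothTransition.zero_of_nonpos (mul_nonpos_of_nonneg_of_nonpos (by positivity) hs)

lemma smoothStep_of_le (n : ℕ) {s : ℝ} (hs : 1 / ((n : ℝ) + 1) ≤ s) : smoothStep n s = 1 := by
  refine Real.smoothTransition.one_of_one_le ?_
  rw [div_le_iff₀ (by positivity)] at hs
  linarith

lemma smoothStep_nonneg (n : ℕ) (s : ℝ) : 0 ≤ smoothStep n s := Real.smoothTransition.nonneg _

lemma smoothStep_le_one (n : ℕ) (s : ℝ) : smoothStep n s ≤ 1 := Real.smoothTransition.le_one _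

lemma monotone_smoothStep (n : ℕ) : Monotone (smoothStep n) := fun _ _ h =>
  Real.smoothTransition.monotone (mul_le_mul_of_nonneg_left h (by positivity))

lemma deriv_smoothStep_nonneg (n : ℕ) (s : ℝ) : 0 ≤ deriv (smoothStep n) s :=
  (monotone_smoothStep n).deriv_nonneg

/-- Such points are global minima of the step; this argument covers the endpoint `s = 0` too. -/
lemma deriv_smoothStep_of_nonpos (n : ℕ) {s : ℝ} (hs : s ≤ 0) : deriv (smoothStep n) s = 0 :=
  (IsLocalMin.deriv_eq_zero (a := s) (.of_forall fun x => by
    rw [smoothStep_of_nonpos n hs]; exact smoothStep_nonneg n x))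

lemma deriv_smoothStep_of_le (n : ℕ) {s : ℝ} (hs : 1 / ((n : ℝ) + 1) ≤ s) :
    deriv (smoothStep n) s = 0 :=
  (IsLocalMax.deriv_eq_zero (a := s) (.of_forall fun x => by
    rw [smoothStep_of_le n hs]; exact smoothStep_le_one n x))

lemma support_deriv_smoothStep_subset (n : ℕ) :
    Function.support (deriv (smoothStep n)) ⊆ Icc 0 (1 / ((n : ℝ) + 1)) := by
  intro s hs
  by_contra h
  rcases le_or_gt s 0 with h0 | h0
  · exact hs (deriv_smoothStep_of_nonpos n h0)
  · exact hs (deriv_smoothStep_of_le n (not_lt.1 fun h1 => h ⟨h0.le, h1.le⟩))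

lemma hasCompactSupport_deriv_smoothStep (n : ℕ) : HasCompactSupport (deriv (smoothStep n)) :=
  HasCompactSupport.of_support_subset_isCompact isCompact_Icc (support_deriv_smoothStep_subset n)

lemma integral_deriv_smoothStep (n : ℕ) : ∫ s, deriv (smoothStep n) s = 1 := by
  have h := integral_of_hasDerivAt_of_tendsto (f := smoothStep n) (m := 0) (n := 1)
    (hasDerivAt_smoothStep n) ((continuous_deriv_smoothStep n).integrable_of_hasCompactSupport
      (hasCompactSupport_deriv_smoothStep n))
    (tendsto_const_nhds.congr' ?_) (tendsto_const_nhds.congr' ?_)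
  · simpa using h
  · filter_upwards [eventually_le_atBot 0] with s hs using (smoothStep_of_nonpos n hs).symm
  · filter_upwards [eventually_ge_atTop (1 / ((n : ℝ) + 1))] with s hs
      using (smoothStep_of_le n hs).symm

lemma eventually_smoothStep_eq_one {c : ℝ} (hc : 0 < c) :
    ∀ᶠ n : ℕ in atTop, ∀ s, c ≤ s → smoothStep n s = 1 := by
  filter_upwards [tendsto_one_div_add_atTop_nhds_zero_nat.eventually_lt_const hc] with n hn s hs
  exact smoothStep_of_le n (hn.le.trans hs)

lemma tendsto_smoothStep (s : ℝ) :
    Tendsto (fun n => smoothStep n s) atTop (𝓝 (if 0 < s then 1 else 0)) := by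
  refine tendsto_const_nhds.congr' ?_
  split_ifs with h
  · filter_upwards [eventually_smoothStep_eq_one h] with n hn using (hn s le_rfl).symm
  · exact .of_forall fun n => (smoothStep_of_nonpos n (not_lt.1 h)).symm

lemma tendsto_support_deriv_smoothStep :
    Tendsto (fun n => Function.support (deriv (smoothStep n))) atTop (𝓝 0).smallSets := by
  have h : Tendsto (fun n : ℕ => Icc (0 : ℝ) (1 / ((n : ℝ) + 1))) atTop (𝓝 0).smallSets :=
    tendsto_const_nhds.Icc tendsto_one_div_add_atTop_nhds_zero_nat
  rw [tendsto_smallSets_iff] at h ⊢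
  intro t ht
  filter_upwards [h t ht] with n hn using (support_deriv_smoothStep_subset n).trans hn

/-- The derivative concentrates at `x = A`, where the other step is eventually `1` because `A + B >
0`. This produces the point values of `u₀` at the feet of the light triangle. -/
lemma tendsto_integral_mul_deriv_smoothStep_mul_smoothStep {f : ℝ → ℝ} (hf : Continuous f)
    {A B : ℝ} (hAB : 0 < A + B) :
    Tendsto (fun n => ∫ x, f x * (deriv (smoothStep n) (A - x) * smoothStep n (B + x))) atTop
      (𝓝 (f A)) := by
  have h := convolution_tendsto_right (μ := (volume : Measure ℝ)) (l := atTop)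
    (g := fun (n : ℕ) (x : ℝ) => f x * smoothStep n (B + x)) (x₀ := A) (z₀ := f A)
    (φ := fun n => deriv (smoothStep n)) (k := fun _ => A)
    (.of_forall deriv_smoothStep_nonneg) (.of_forall integral_deriv_smoothStep)
    tendsto_support_deriv_smoothStep
    (.of_forall fun n => (hf.mul ((continuous_smoothStep n).comp
      (continuous_const.add continuous_id))).aestronglyMeasurable) ?_ tendsto_const_nhds
  · refine h.congr fun n => ?_
    rw [convolution_lsmul_swap]
    refine integral_congr_ae (.of_forall fun x => ?_)
    simp only [smul_eq_mul]
    ring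
  · have hlim : Tendsto (fun p : ℕ × ℝ => f p.2) (atTop ×ˢ 𝓝 A) (𝓝 (f A)) :=
      (hf.tendsto A).comp tendsto_snd
    refine hlim.congr' ?_
    filter_upwards [(eventually_smoothStep_eq_one (half_pos hAB)).prod_mk
      (lt_mem_nhds (show A - (A + B) / 2 < A by linarith))] with p hp
    simp [Function.uncurry, hp.1 (B + p.2) (by linarith [hp.2])]

/-- Continuity is asked only at `q` because `g` will be the solution cut off to `t > 0`, which may
jump across the initial line. -/
lemma tendsto_integral_mul_deriv_smoothStep_prod {g : ℝ × ℝ → ℝ} (hg : AEStronglyMeasurable g)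
    {q : ℝ × ℝ} (hq : ContinuousAt g q) :
    Tendsto (fun n => ∫ p : ℝ × ℝ,
      g p * (deriv (smoothStep n) (q.1 - p.1) * deriv (smoothStep n) (q.2 - p.2))) atTop
      (𝓝 (g q)) := by
  have h := convolution_tendsto_right (μ := (volume : Measure (ℝ × ℝ))) (l := atTop)
    (g := fun (_ : ℕ) => g) (x₀ := q) (z₀ := g q)
    (φ := fun n p => deriv (smoothStep n) p.1 * deriv (smoothStep n) p.2) (k := fun _ => q)
    (.of_forall fun n p => mul_nonneg (deriv_smoothStep_nonneg n _) (deriv_smoothStep_nonneg n _))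
    (.of_forall fun n => ?_) ?_
    (.of_forall fun n => hg) (hq.tendsto.comp tendsto_snd) tendsto_const_nhds
  · refine h.congr fun n => ?_
    rw [convolution_lsmul_swap]
    refine integral_congr_ae (.of_forall fun x => ?_)
    simp only [smul_eq_mul, Prod.fst_sub, Prod.snd_sub]
    ring
  · rw [Measure.volume_eq_prod, integral_prod_mul, integral_deriv_smoothStep, one_mul]
  · rw [tendsto_smallSets_iff]
    intro t ht
    obtain ⟨v, hv, w, hw, hvw⟩ := mem_nhds_prod_iff.1 ht
    have hs := tendsto_smallSets_iff.1 tendsto_support_deriv_smoothStep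
    filter_upwards [hs v hv, hs w hw] with n h1 h2 p hp
    exact hvw ⟨h1 (left_ne_zero_of_mul hp), h2 (right_ne_zero_of_mul hp)⟩

end SmoothStep

/-! ### From the weak formulation to the integral equation -/

section MildEquation

open Filter Topology

/-- `u` in the null coordinates `(t + x, t - x)`, extended to `t < 0` by its values at `t = 0`. -/
noncomputable def nullForm (u : ℝ → ℝ → ℝ) (q : ℝ × ℝ) : ℝ :=
  u (max ((q.1 + q.2) / 2) 0) ((q.1 - q.2) / 2)

lemma nullForm_apply (u : ℝ → ℝ → ℝ) {t : ℝ} (ht : 0 ≤ t) (x : ℝ) :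
    nullForm u (t + x, t - x) = u t x := by
  have h1 : (t + x + (t - x)) / 2 = t := by ring
  have h2 : (t + x - (t - x)) / 2 = x := by ring
  simp only [nullForm, h1, h2, max_eq_left ht]

/-- Clamping time at `0` keeps the argument inside the closed half-space where `u` is continuous. -/
lemma IsCubicWaveSolution.continuous_nullForm {u₀ u₁ : ℝ → ℝ} {u : ℝ → ℝ → ℝ}
    (hu : IsCubicWaveSolution u₀ u₁ u) : Continuous (nullForm u) :=
  hu.continuousOn.comp_continuous
    (f := fun q : ℝ × ℝ => (max ((q.1 + q.2) / 2) 0, (q.1 - q.2) / 2)) (by fun_prop)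
    fun q => ⟨mem_Ici.2 (le_max_right _ _), mem_univ _⟩

/-- The open half-plane `t > 0` in null coordinates. -/
def futureHalfPlane : Set (ℝ × ℝ) := {q | 0 < q.1 + q.2}

lemma isOpen_futureHalfPlane : IsOpen futureHalfPlane :=
  isOpen_lt continuous_const (continuous_fst.add continuous_snd)

/-- The backward light triangle with apex `(A, B)` in null coordinates. -/
def lightTriangle (A B : ℝ) : Set (ℝ × ℝ) := futureHalfPlane ∩ Iio A ×ˢ Iio B

lemma lightTriangle_subset (A B : ℝ) : lightTriangle A B ⊆ Icc (-B) A ×ˢ Icc (-A) B := by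
  rintro ⟨a, b⟩ ⟨h0, ha, hb⟩
  simp only [futureHalfPlane, mem_ofPred_eq, mem_Iio] at h0 ha hb
  exact ⟨⟨by linarith, ha.le⟩, ⟨by linarith, hb.le⟩⟩

lemma measurableSet_lightTriangle (A B : ℝ) : MeasurableSet (lightTriangle A B) :=
  isOpen_futureHalfPlane.measurableSet.inter (measurableSet_Iio.prod measurableSet_Iio)

lemma setIntegral_null_coordinates (f : ℝ × ℝ → ℝ) :
    ∫ p in (Ioi (0 : ℝ)) ×ˢ (univ : Set ℝ), f (p.1 + p.2, p.1 - p.2)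
      = (1 / 2) * ∫ q in futureHalfPlane, f q := by
  rw [← integral_indicator (measurableSet_Ioi.prod MeasurableSet.univ),
    ← integral_indicator isOpen_futureHalfPlane.measurableSet, ← integral_null_coordinates]
  refine integral_congr_ae (.of_forall ?_)
  rintro ⟨t, x⟩
  change _ = futureHalfPlane.indicator f (t + x, t - x)
  by_cases ht : 0 < t
  · rw [indicator_of_mem (show (t, x) ∈ Ioi (0 : ℝ) ×ˢ univ from ⟨ht, mem_univ _⟩),
      indicator_of_mem (show (t + x, t - x) ∈ futureHalfPlane by
        simp only [futureHalfPlane, mem_ofPred_eq]; linarith)]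
  · rw [indicator_of_notMem (show (t, x) ∉ Ioi (0 : ℝ) ×ˢ univ from fun h => ht h.1),
      indicator_of_notMem (show (t + x, t - x) ∉ futureHalfPlane by
        simp only [futureHalfPlane, mem_ofPred_eq]; linarith)]

lemma smoothStep_mul_eq_zero_of_notMem (n : ℕ) {A B x : ℝ} (hx : x ∉ Icc (-B) A) :
    smoothStep n (A - x) * smoothStep n (B + x) = 0 := by
  rw [mul_eq_zero]
  by_cases h : A ≤ x
  · exact .inl (smoothStep_of_nonpos n (by linarith))
  · refine .inr (smoothStep_of_nonpos n ?_)
    by_contra h'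
    exact hx ⟨by linarith, by linarith⟩

lemma tendsto_integral_mul_smoothStep_mul_smoothStep {f : ℝ → ℝ} (hf : Continuous f) (A B : ℝ) :
    Tendsto (fun n => ∫ x, f x * (smoothStep n (A - x) * smoothStep n (B + x))) atTop
      (𝓝 (∫ x in Ioo (-B) A, f x)) := by
  rw [← integral_indicator measurableSet_Ioo]
  refine tendsto_integral_of_dominated_convergence ((Icc (-B) A).indicator fun x => ‖f x‖)
    (fun n => ?_) ?_ (fun n => .of_forall fun x => ?_) (.of_forall fun x => ?_)
  · have := continuous_smoothStep n
    exact Continuous.aestronglyMeasurable (by fun_prop)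
  · exact (integrable_indicator_iff measurableSet_Icc).2
      (hf.norm.continuousOn.integrableOn_compact isCompact_Icc)
  · by_cases hx : x ∈ Icc (-B) A
    · rw [indicator_of_mem hx, norm_mul, Real.norm_of_nonneg
        (mul_nonneg (smoothStep_nonneg n _) (smoothStep_nonneg n _))]
      exact mul_le_of_le_one_right (norm_nonneg _)
        (mul_le_one₀ (smoothStep_le_one n _) (smoothStep_nonneg n _) (smoothStep_le_one n _))
    · rw [smoothStep_mul_eq_zero_of_notMem n hx, indicator_of_notMem hx, mul_zero, norm_zero]
  · have h := ((tendsto_smoothStep (A - x)).mul (tendsto_smoothStep (B + x))).const_mul (f x)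
    convert h using 2
    by_cases hx : x ∈ Ioo (-B) A
    · rw [indicator_of_mem hx, if_pos (by linarith [hx.2]), if_pos (by linarith [hx.1])]
      ring
    · rw [indicator_of_notMem hx]
      split_ifs with h1 h2
      · exact absurd ⟨by linarith, by linarith⟩ hx
      all_goals simp

lemma smoothStep_prod_eq_zero_of_notMem (n : ℕ) {A B : ℝ} {q : ℝ × ℝ}
    (h0 : q ∈ futureHalfPlane) (hq : q ∉ lightTriangle A B) :
    smoothStep n (A - q.1) * smoothStep n (B - q.2) = 0 := by
  rw [mul_eq_zero]
  by_cases h : A ≤ q.1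
  · exact .inl (smoothStep_of_nonpos n (by linarith))
  · refine .inr (smoothStep_of_nonpos n ?_)
    by_contra h'
    exact hq ⟨h0, not_le.1 h, by simp only [mem_Iio]; linarith⟩

lemma norm_mul_smoothStep_prod_le {f : ℝ × ℝ → ℝ} (A B : ℝ) (n : ℕ) {q : ℝ × ℝ}
    (hq : q ∈ futureHalfPlane) :
    ‖f q * (smoothStep n (A - q.1) * smoothStep n (B - q.2))‖
      ≤ (lightTriangle A B).indicator (fun q => ‖f q‖) q := by
  by_cases hq' : q ∈ lightTriangle A B
  · rw [indicator_of_mem hq', norm_mul, Real.norm_of_nonneg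
      (mul_nonneg (smoothStep_nonneg n _) (smoothStep_nonneg n _))]
    exact mul_le_of_le_one_right (norm_nonneg _)
      (mul_le_one₀ (smoothStep_le_one n _) (smoothStep_nonneg n _) (smoothStep_le_one n _))
  · rw [smoothStep_prod_eq_zero_of_notMem n hq hq', indicator_of_notMem hq', mul_zero, norm_zero]

lemma Continuous.integrableOn_lightTriangle {f : ℝ × ℝ → ℝ} (hf : Continuous f) (A B : ℝ) :
    IntegrableOn f (lightTriangle A B) :=
  (hf.continuousOn.integrableOn_compact (isCompact_Icc.prod isCompact_Icc)).mono_set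
    (lightTriangle_subset A B)

lemma integrableOn_mul_smoothStep_prod {f : ℝ × ℝ → ℝ} (hf : Continuous f) (A B : ℝ) (n : ℕ) :
    IntegrableOn (fun q => f q * (smoothStep n (A - q.1) * smoothStep n (B - q.2)))
      futureHalfPlane := by
  have hc := continuous_smoothStep n
  refine Integrable.mono' (g := (lightTriangle A B).indicator fun q => ‖f q‖)
    ((integrable_indicator_iff (measurableSet_lightTriangle A B)).2
      (hf.norm.integrableOn_lightTriangle A B)).restrict
    (Continuous.aestronglyMeasurable (by fun_prop)) ?_
  exact (ae_restrict_iff' isOpen_futureHalfPlane.measurableSet).2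
    (.of_forall fun q hq => norm_mul_smoothStep_prod_le A B n hq)

lemma tendsto_setIntegral_mul_smoothStep_prod {f : ℝ × ℝ → ℝ} (hf : Continuous f) (A B : ℝ) :
    Tendsto (fun n => ∫ q in futureHalfPlane,
      f q * (smoothStep n (A - q.1) * smoothStep n (B - q.2))) atTop
      (𝓝 (∫ q in lightTriangle A B, f q)) := by
  have e : ∫ q in lightTriangle A B, f q =
      ∫ q in futureHalfPlane, (lightTriangle A B).indicator f q := by
    rw [setIntegral_indicator (measurableSet_lightTriangle A B), lightTriangle,
      inter_eq_self_of_subset_right inter_subset_left]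
  rw [e]
  refine tendsto_integral_of_dominated_convergence
    ((lightTriangle A B).indicator fun q => ‖f q‖)
    (fun n => (integrableOn_mul_smoothStep_prod hf A B n).aestronglyMeasurable)
    ((integrable_indicator_iff (measurableSet_lightTriangle A B)).2
      (hf.norm.integrableOn_lightTriangle A B)).restrict
    (fun n => (ae_restrict_iff' isOpen_futureHalfPlane.measurableSet).2
      (.of_forall fun q hq => norm_mul_smoothStep_prod_le A B n hq))
    ((ae_restrict_iff' isOpen_futureHalfPlane.measurableSet).2 (.of_forall fun q hq => ?_))
  have h := ((tendsto_smoothStep (A - q.1)).mul (tendsto_smoothStep (B - q.2))).const_mul (f q)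
  convert h using 2
  by_cases hq' : q ∈ lightTriangle A B
  · rw [indicator_of_mem hq', if_pos (sub_pos.2 hq'.2.1), if_pos (sub_pos.2 hq'.2.2)]
    ring
  · rw [indicator_of_notMem hq']
    split_ifs with h1 h2
    · exact absurd ⟨hq, sub_pos.1 h1, sub_pos.1 h2⟩ hq'
    all_goals simp

lemma integrable_mul_deriv_smoothStep_prod {f : ℝ × ℝ → ℝ} (hf : Continuous f) (A B : ℝ) (n : ℕ) :
    Integrable fun q : ℝ × ℝ =>
      f q * (deriv (smoothStep n) (A - q.1) * deriv (smoothStep n) (B - q.2)) := by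
  have hc := continuous_deriv_smoothStep n
  refine Continuous.integrable_of_hasCompactSupport (by fun_prop)
    (HasCompactSupport.intro (K := Icc (A - 1 / ((n : ℝ) + 1)) A ×ˢ Icc (B - 1 / ((n : ℝ) + 1)) B)
      (isCompact_Icc.prod isCompact_Icc) fun q hq => ?_)
  by_contra h
  have h1 := support_deriv_smoothStep_subset n (left_ne_zero_of_mul (right_ne_zero_of_mul h))
  have h2 := support_deriv_smoothStep_subset n (right_ne_zero_of_mul (right_ne_zero_of_mul h))
  exact hq ⟨⟨by linarith [h1.2], by linarith [h1.1]⟩, ⟨by linarith [h2.2], by linarith [h2.1]⟩⟩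

lemma integrable_mul_smoothStep_mul_smoothStep {f : ℝ → ℝ} (hf : Continuous f) (A B : ℝ) (n : ℕ) :
    Integrable fun x => f x * (smoothStep n (A - x) * smoothStep n (B + x)) := by
  have hc := continuous_smoothStep n
  refine Continuous.integrable_of_hasCompactSupport (by fun_prop)
    (HasCompactSupport.intro (K := Icc (-B) A) isCompact_Icc fun x hx => ?_)
  rw [smoothStep_mul_eq_zero_of_notMem n hx, mul_zero]

lemma integrable_mul_deriv_smoothStep_mul_smoothStep {f : ℝ → ℝ} (hf : Continuous f) (A B : ℝ)
    (n : ℕ) :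
    Integrable fun x => f x * (deriv (smoothStep n) (A - x) * smoothStep n (B + x)) := by
  have hc := continuous_smoothStep n
  have hc' := continuous_deriv_smoothStep n
  refine Continuous.integrable_of_hasCompactSupport (by fun_prop)
    (HasCompactSupport.intro (K := Icc (A - 1 / ((n : ℝ) + 1)) A) isCompact_Icc fun x hx => ?_)
  by_contra h
  have h1 := support_deriv_smoothStep_subset n (left_ne_zero_of_mul (right_ne_zero_of_mul h))
  exact hx ⟨by linarith [h1.2], by linarith [h1.1]⟩

/-- The product of the two steps approximates the indicator of the light triangle with apex `(A,
B)`, and the wave operator turns it into four times an approximate delta at the apex. The Jacobian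
`1 / 2` of the null coordinates accounts for the factors `2` and `1 / 2`. The last integral is
reflected so that a single limit lemma handles both `u₀` terms. -/
lemma IsCubicWaveSolution.weak_eq_smoothStep {u₀ u₁ : ℝ → ℝ} {u : ℝ → ℝ → ℝ}
    (hu : IsCubicWaveSolution u₀ u₁ u) (h₀ : Continuous u₀) (h₁ : Continuous u₁) (A B : ℝ) (n : ℕ) :
    2 * (∫ q, futureHalfPlane.indicator (nullForm u) q *
        (deriv (smoothStep n) (A - q.1) * deriv (smoothStep n) (B - q.2)))
      + (1 / 2) * (∫ q in futureHalfPlane,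
        nullForm u q ^ 3 * (smoothStep n (A - q.1) * smoothStep n (B - q.2)))
      = (∫ x, u₁ x * (smoothStep n (A - x) * smoothStep n (B + x)))
        + (∫ x, u₀ x * (deriv (smoothStep n) (A - x) * smoothStep n (B + x)))
        + ∫ x, u₀ (-x) * (deriv (smoothStep n) (B - x) * smoothStep n (A + x)) := by
  have hv := hu.continuous_nullForm
  have hd : ∀ c x, deriv (fun a => smoothStep n (c - a)) x = -deriv (smoothStep n) (c - x) :=
    fun c x => ((hasDerivAt_smoothStep n (c - x)).comp_const_sub c x).deriv
  have key := hu.weak_eq_mul_null (P := fun a => smoothStep n (A - a))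
    (Q := fun b => smoothStep n (B - b)) (A := A) (B := B)
    ((contDiff_smoothStep n).comp (contDiff_const.sub contDiff_id))
    ((contDiff_smoothStep n).comp (contDiff_const.sub contDiff_id))
    (fun a ha => smoothStep_of_nonpos n (by linarith))
    (fun b hb => smoothStep_of_nonpos n (by linarith))
  simp only [hd] at key
  let F : ℝ × ℝ → ℝ := fun q =>
    4 * (nullForm u q * (deriv (smoothStep n) (A - q.1) * deriv (smoothStep n) (B - q.2)))
      + nullForm u q ^ 3 * (smoothStep n (A - q.1) * smoothStep n (B - q.2))
  have hL : ∀ p ∈ (Ioi (0 : ℝ)) ×ˢ (univ : Set ℝ),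
      u p.1 p.2 * (4 * -deriv (smoothStep n) (A - (p.1 + p.2)) *
          -deriv (smoothStep n) (B - (p.1 - p.2)))
        + u p.1 p.2 ^ 3 * (smoothStep n (A - (p.1 + p.2)) * smoothStep n (B - (p.1 - p.2)))
      = F (p.1 + p.2, p.1 - p.2) := by
    rintro ⟨t, x⟩ ⟨ht, -⟩
    simp only [F, nullForm_apply u (le_of_lt ht)]
    ring
  rw [setIntegral_congr_fun (measurableSet_Ioi.prod MeasurableSet.univ) hL,
    setIntegral_null_coordinates] at key
  have hind : (fun q => futureHalfPlane.indicator (nullForm u) q *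
        (deriv (smoothStep n) (A - q.1) * deriv (smoothStep n) (B - q.2))) =
      futureHalfPlane.indicator (fun q => nullForm u q *
        (deriv (smoothStep n) (A - q.1) * deriv (smoothStep n) (B - q.2))) := by
    funext q
    by_cases hq : q ∈ futureHalfPlane <;> simp [hq]
  rw [hind, integral_indicator isOpen_futureHalfPlane.measurableSet]
  have hF : ∫ q in futureHalfPlane, F q = 4 * (∫ q in futureHalfPlane, nullForm u q *
        (deriv (smoothStep n) (A - q.1) * deriv (smoothStep n) (B - q.2)))
      + ∫ q in futureHalfPlane,
        nullForm u q ^ 3 * (smoothStep n (A - q.1) * smoothStep n (B - q.2)) := by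
    rw [← integral_const_mul]
    exact integral_add (((integrable_mul_deriv_smoothStep_prod hv A B n).restrict).const_mul 4)
      (integrableOn_mul_smoothStep_prod (hv.pow 3) A B n)
  have hrefl : ∫ x, u₀ (-x) * (deriv (smoothStep n) (B - x) * smoothStep n (A + x)) =
      ∫ x, u₀ x * (deriv (smoothStep n) (B + x) * smoothStep n (A - x)) := by
    rw [← integral_neg_eq_self]
    simp [sub_eq_add_neg]
  have hI1 := integrable_mul_smoothStep_mul_smoothStep h₁ A B n
  have hI2 := integrable_mul_deriv_smoothStep_mul_smoothStep h₀ A B n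
  have hI3 : Integrable fun x => u₀ x * (deriv (smoothStep n) (B + x) * smoothStep n (A - x)) := by
    have h := (integrable_mul_deriv_smoothStep_mul_smoothStep
      (h₀.comp continuous_neg) B A n).comp_neg
    simpa [sub_eq_add_neg] using h
  have hsum := integral_add (hI1.add hI2) hI3
  simp only [Pi.add_apply] at hsum
  rw [integral_add hI1 hI2] at hsum
  rw [hF] at key
  rw [hrefl, ← hsum]
  refine (Eq.trans (by ring) key).trans (integral_congr_ae (.of_forall fun x => ?_))
  simp only [sub_neg_eq_add]
  ring

/-- d'Alembert's formula with Duhamel's term, in null coordinates. -/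
lemma IsCubicWaveSolution.duhamel {u₀ u₁ : ℝ → ℝ} {u : ℝ → ℝ → ℝ}
    (hu : IsCubicWaveSolution u₀ u₁ u) (h₀ : Continuous u₀) (h₁ : Continuous u₁) {A B : ℝ}
    (hAB : 0 < A + B) :
    2 * nullForm u (A, B) + (1 / 2) * ∫ q in lightTriangle A B, nullForm u q ^ 3
      = (∫ x in Ioo (-B) A, u₁ x) + u₀ A + u₀ (-B) := by
  have hv := hu.continuous_nullForm
  have hmem : (A, B) ∈ futureHalfPlane := hAB
  -- The apex lies in the open half-plane, so the cutoff is invisible near it.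
  have hev : futureHalfPlane.indicator (nullForm u) =ᶠ[𝓝 (A, B)] nullForm u := by
    filter_upwards [isOpen_futureHalfPlane.mem_nhds hmem] with q hq using indicator_of_mem hq _
  have h1 := tendsto_integral_mul_deriv_smoothStep_prod
    (hv.aestronglyMeasurable.indicator isOpen_futureHalfPlane.measurableSet)
    (hv.continuousAt.congr hev.symm)
  rw [hev.eq_of_nhds] at h1
  have hl := (h1.const_mul 2).add
    ((tendsto_setIntegral_mul_smoothStep_prod (hv.pow 3) A B).const_mul (1 / 2))
  have hr := ((tendsto_integral_mul_smoothStep_mul_smoothStep h₁ A B).add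
    (tendsto_integral_mul_deriv_smoothStep_mul_smoothStep h₀ hAB)).add
    (tendsto_integral_mul_deriv_smoothStep_mul_smoothStep (h₀.comp continuous_neg)
      (show 0 < B + A by linarith))
  exact tendsto_nhds_unique hl (hr.congr fun n => (hu.weak_eq_smoothStep h₀ h₁ A B n).symm)

end MildEquation

/-! ### Energy identity and growth bound in null coordinates -/

section Energy

open Filter Topology intervalIntegral

lemma setIntegral_lightTriangle {F : ℝ × ℝ → ℝ} (hF : Continuous F) {A B : ℝ} (hAB : 0 ≤ A + B) :
    ∫ q in lightTriangle A B, F q = ∫ a in (-B)..A, ∫ b in (-a)..B, F (a, b) := by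
  have hint : Integrable ((lightTriangle A B).indicator F) (volume.prod volume) :=
    (integrable_indicator_iff (measurableSet_lightTriangle A B)).2
      (hF.integrableOn_lightTriangle A B)
  have hslice : ∀ a, ∫ b, (lightTriangle A B).indicator F (a, b) =
      (Ioo (-B) A).indicator (fun a => ∫ b in (-a)..B, F (a, b)) a := by
    intro a
    by_cases ha : a ∈ Ioo (-B) A
    · rw [indicator_of_mem ha, integral_of_le (by linarith [ha.1]), integral_Ioc_eq_integral_Ioo,
        ← MeasureTheory.integral_indicator measurableSet_Ioo]
      refine integral_congr_ae (.of_forall fun b => ?_)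
      by_cases hb : b ∈ Ioo (-a) B
      · have hm : (a, b) ∈ lightTriangle A B :=
          ⟨show 0 < a + b by linarith [hb.1], ha.2, hb.2⟩
        simp only [indicator_of_mem hb, indicator_of_mem hm]
      · have hm : (a, b) ∉ lightTriangle A B := fun h =>
          hb ⟨by linarith [show 0 < a + b from h.1], h.2.2⟩
        simp only [indicator_of_notMem hb, indicator_of_notMem hm]
    · rw [indicator_of_notMem ha]
      refine integral_eq_zero_of_ae (.of_forall fun b => ?_)
      refine indicator_of_notMem (fun h => ha ⟨?_, h.2.1⟩) _
      have h1 : 0 < a + b := h.1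
      have h2 : b < B := h.2.2
      linarith
  rw [← MeasureTheory.integral_indicator (measurableSet_lightTriangle A B), Measure.volume_eq_prod,
    integral_prod _ hint]
  simp only [hslice]
  rw [MeasureTheory.integral_indicator measurableSet_Ioo, integral_of_le (by linarith),
    integral_Ioc_eq_integral_Ioo]

lemma setIntegral_lightTriangle_swap (F : ℝ × ℝ → ℝ) (A B : ℝ) :
    ∫ q in lightTriangle B A, F q.swap = ∫ q in lightTriangle A B, F q := by
  rw [← MeasureTheory.integral_indicator (measurableSet_lightTriangle A B),
    ← MeasureTheory.integral_indicator (measurableSet_lightTriangle B A), Measure.volume_eq_prod,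
    ← integral_prod_swap ((lightTriangle A B).indicator F)]
  refine integral_congr_ae (.of_forall fun q => ?_)
  have h : q ∈ lightTriangle B A ↔ q.swap ∈ lightTriangle A B := by
    simp only [lightTriangle, futureHalfPlane, mem_inter_iff, mem_ofPred_eq, mem_prod, mem_Iio,
      Prod.fst_swap, Prod.snd_swap, add_comm q.2, and_comm (a := q.2 < A)]
  by_cases hq : q ∈ lightTriangle B A
  · simp only [indicator_of_mem hq, indicator_of_mem (h.1 hq)]
  · simp only [indicator_of_notMem hq, indicator_of_notMem (fun hs => hq (h.2 hs))]

/-- The integral equation for `4 v_ab = -v³` in null coordinates; `(f a + g b) / 2` is the free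
solution with the same data on the line `a + b = 0`. -/
structure IsNullSolution (v : ℝ × ℝ → ℝ) (f f' g g' : ℝ → ℝ) : Prop where
  continuous : Continuous v
  hasDerivAt_left : ∀ a, HasDerivAt f (f' a) a
  continuous_left : Continuous f'
  hasDerivAt_right : ∀ b, HasDerivAt g (g' b) b
  continuous_right : Continuous g'
  duhamel : ∀ A B, 0 < A + B →
    2 * v (A, B) + (1 / 2) * ∫ q in lightTriangle A B, v q ^ 3 = f A + g B

namespace IsNullSolution

variable {v : ℝ × ℝ → ℝ} {f f' g g' : ℝ → ℝ}

lemma symm (h : IsNullSolution v f f' g g') : IsNullSolution (v ∘ Prod.swap) g g' f f' where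
  continuous := h.continuous.comp continuous_swap
  hasDerivAt_left := h.hasDerivAt_right
  continuous_left := h.continuous_right
  hasDerivAt_right := h.hasDerivAt_left
  continuous_right := h.continuous_left
  duhamel A B hAB := by
    have e := setIntegral_lightTriangle_swap (fun q => v q ^ 3) B A
    simp only [Function.comp_apply, e, Prod.swap_prod_mk]
    rw [h.duhamel B A (by linarith), add_comm]

end IsNullSolution

/-- The derivative `v_a` of a solution of `4 v_ab = -v³` with `v_a = f' / 2` on `a + b = 0`. -/
noncomputable def nullDeriv (v : ℝ × ℝ → ℝ) (f' : ℝ → ℝ) (q : ℝ × ℝ) : ℝ :=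
  f' q.1 / 2 - (1 / 4) * ∫ b in (-q.1)..q.2, v (q.1, b) ^ 3

namespace IsNullSolution

variable {v : ℝ × ℝ → ℝ} {f f' g g' : ℝ → ℝ}

/-- Splitting at `0` reduces two moving endpoints to one. -/
lemma continuous_integral_slice (hv : Continuous v) {l r : ℝ × ℝ → ℝ} (hl : Continuous l)
    (hr : Continuous r) :
    Continuous fun q : ℝ × ℝ => ∫ b in (l q)..(r q), v (q.1, b) ^ 3 := by
  have hu : Continuous (Function.uncurry fun (q : ℝ × ℝ) (b : ℝ) => v (q.1, b) ^ 3) :=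
    (hv.comp (by fun_prop : Continuous fun p : (ℝ × ℝ) × ℝ => (p.1.1, p.2))).pow 3
  have hi : ∀ q : ℝ × ℝ, ∀ c d : ℝ, IntervalIntegrable (fun b => v (q.1, b) ^ 3) volume c d :=
    fun q c d => ((hv.comp (by fun_prop : Continuous fun b : ℝ => (q.1, b))).pow
      3).intervalIntegrable c d
  have e : (fun q : ℝ × ℝ => ∫ b in (l q)..(r q), v (q.1, b) ^ 3) = fun q =>
      (∫ b in (0)..(r q), v (q.1, b) ^ 3) - ∫ b in (0)..(l q), v (q.1, b) ^ 3 :=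
    funext fun q => (integral_interval_sub_left (hi q _ _) (hi q _ _)).symm
  rw [e]
  exact (continuous_parametric_intervalIntegral_of_continuous hu hr).sub
    (continuous_parametric_intervalIntegral_of_continuous hu hl)

lemma continuous_nullDeriv (h : IsNullSolution v f f' g g') : Continuous (nullDeriv v f') :=
  ((h.continuous_left.comp continuous_fst).div_const 2).sub (continuous_const.mul
    (continuous_integral_slice h.continuous continuous_fst.neg continuous_snd))

lemma hasDerivAt_nullDeriv (hv : Continuous v) (f' : ℝ → ℝ) (a b : ℝ) :
    HasDerivAt (fun b => nullDeriv v f' (a, b)) (-(1 / 4) * v (a, b) ^ 3) b := by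
  have hc : Continuous fun b => v (a, b) ^ 3 :=
    (hv.comp (by fun_prop : Continuous fun b : ℝ => (a, b))).pow 3
  have h := (((hc.integral_hasStrictDerivAt (-a) b).hasDerivAt).const_mul (1 / 4)).const_sub
    (f' a / 2)
  exact h.congr_deriv (by ring)

/-- With `b` fixed, `a` enters the double integral only as the outer upper limit, so the fundamental
theorem of calculus suffices and no differentiation under the integral occurs. -/
lemma hasDerivAt_iterated (h : IsNullSolution v f f' g g') (a b : ℝ) :
    HasDerivAt (fun a => (f a + g b) / 2
      - (1 / 4) * ∫ α in (-b)..a, ∫ β in (-α)..b, v (α, β) ^ 3) (nullDeriv v f' (a, b)) a := by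
  have hc : Continuous fun α : ℝ => ∫ β in (-α)..b, v (α, β) ^ 3 :=
    (continuous_integral_slice h.continuous continuous_fst.neg continuous_snd).comp
      (by fun_prop : Continuous fun α : ℝ => (α, b))
  exact (((h.hasDerivAt_left a).add_const (g b)).div_const 2).sub
    (((hc.integral_hasStrictDerivAt (-b) a).hasDerivAt).const_mul (1 / 4))

lemma eq_iterated (h : IsNullSolution v f f' g g') {a b : ℝ} (hab : 0 < a + b) :
    v (a, b) = (f a + g b) / 2
      - (1 / 4) * ∫ α in (-b)..a, ∫ β in (-α)..b, v (α, β) ^ 3 := by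
  have h1 := h.duhamel a b hab
  rw [setIntegral_lightTriangle (F := fun q => v q ^ 3) (h.continuous.pow 3) hab.le] at h1
  linarith

lemma hasDerivAt (h : IsNullSolution v f f' g g') {a b : ℝ} (hab : 0 < a + b) :
    HasDerivAt (fun a => v (a, b)) (nullDeriv v f' (a, b)) a := by
  refine (h.hasDerivAt_iterated a b).congr_of_eventuallyEq ?_
  filter_upwards [lt_mem_nhds (show -b < a by linarith)] with α hα
  exact h.eq_iterated (by linarith)

/-- The integral equation is assumed only above the initial line. Letting `a` decrease to `-b`, both
sides are continuous and the double integral vanishes. -/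
lemma apply_initial (h : IsNullSolution v f f' g g') (b : ℝ) :
    v (-b, b) = (f (-b) + g b) / 2 := by
  have hc : Continuous fun a => v (a, b) :=
    h.continuous.comp (by fun_prop : Continuous fun a : ℝ => (a, b))
  have h1 : Tendsto (fun a => v (a, b)) (𝓝[>] (-b)) (𝓝 (v (-b, b))) :=
    (hc.tendsto (-b)).mono_left nhdsWithin_le_nhds
  have h2 := ((h.hasDerivAt_iterated (-b) b).continuousAt.tendsto).mono_left
    (nhdsWithin_le_nhds (s := Ioi (-b)))
  have h3 := tendsto_nhds_unique h1 (h2.congr' ?_)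
  · simpa using h3
  · filter_upwards [self_mem_nhdsWithin] with a ha
    exact (h.eq_iterated (by linarith [mem_Ioi.1 ha])).symm

/-- Conservation of energy on a backward light triangle, for one of the two null components of the
energy density. -/
lemma energy_eq (h : IsNullSolution v f f' g g') {A B : ℝ} (hAB : 0 ≤ A + B) :
    (∫ a in (-B)..A, nullDeriv v f' (a, B) ^ 2) + (1 / 8) * ∫ b in (-A)..B, v (A, b) ^ 4
      = (∫ a in (-B)..A, (f' a / 2) ^ 2) + (1 / 8) * ∫ b in (-A)..B, v (-b, b) ^ 4 := by
  have hv := h.continuous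
  have hp := h.continuous_nullDeriv
  have hl := h.continuous_left
  have hpv : Continuous fun q => nullDeriv v f' q * v q ^ 3 := hp.mul (hv.pow 3)
  -- Integration in `b` first: `∂_b (v_a²) = 2 v_a v_ab = -v_a v³ / 2`.
  have hi1 : ∀ a, (∫ b in (-a)..B, -(1 / 2) * (nullDeriv v f' (a, b) * v (a, b) ^ 3)) =
      nullDeriv v f' (a, B) ^ 2 - (f' a / 2) ^ 2 := by
    intro a
    have h0 : nullDeriv v f' (a, -a) = f' a / 2 := by simp [nullDeriv]
    rw [← h0]
    refine integral_eq_sub_of_hasDerivAt (f := fun b => nullDeriv v f' (a, b) ^ 2)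
      (fun b _ => ?_) (Continuous.intervalIntegrable (by fun_prop) _ _)
    refine ((hasDerivAt_nullDeriv hv f' a b).pow 2).congr_deriv ?_
    norm_num
    ring
  -- Integration in `a` first: `v_a v³ = ∂_a (v⁴ / 4)`. Differentiability is known only for `a + b >
  -- 0`, hence the version of the theorem using the open interval.
  have hi2 : ∀ b ∈ uIcc (-A) B, (∫ a in (-b)..A, nullDeriv v f' (a, b) * v (a, b) ^ 3) =
      (1 / 4) * v (A, b) ^ 4 - (1 / 4) * v (-b, b) ^ 4 := by
    intro b hb
    rw [uIcc_of_le (by linarith)] at hb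
    refine integral_eq_sub_of_hasDerivAt_of_le (f := fun a => (1 / 4) * v (a, b) ^ 4)
      (by linarith [hb.1]) (Continuous.continuousOn (by fun_prop)) (fun a ha => ?_)
      (Continuous.intervalIntegrable (by fun_prop) _ _)
    refine (((h.hasDerivAt (a := a) (b := b) (by linarith [ha.1])).pow 4).const_mul
      (1 / 4)).congr_deriv ?_
    norm_num
    ring
  -- Reflecting the triangle exchanges the order of integration, which equates the two computations.
  have hswap := setIntegral_lightTriangle_swap (fun q => nullDeriv v f' q * v q ^ 3) A B
  rw [setIntegral_lightTriangle hpv hAB,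
    setIntegral_lightTriangle (F := fun q => nullDeriv v f' q.swap * v q.swap ^ 3)
      (hpv.comp continuous_swap) (by linarith)] at hswap
  simp only [Prod.swap_prod_mk] at hswap
  rw [integral_congr hi2] at hswap
  have e1 : (∫ a in (-B)..A, (nullDeriv v f' (a, B) ^ 2 - (f' a / 2) ^ 2)) =
      -(1 / 2) * ∫ a in (-B)..A, ∫ b in (-a)..B, nullDeriv v f' (a, b) * v (a, b) ^ 3 := by
    rw [← intervalIntegral.integral_const_mul]
    refine integral_congr fun a _ => ?_
    simp only [← hi1, intervalIntegral.integral_const_mul]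
  rw [← hswap, intervalIntegral.integral_sub, intervalIntegral.integral_sub,
    intervalIntegral.integral_const_mul, intervalIntegral.integral_const_mul] at e1
  · linarith
  all_goals exact Continuous.intervalIntegrable (by fun_prop) _ _

variable {M : ℝ}

lemma initial_energy_le (h : IsNullSolution v f f' g g') (hf : ∀ a, |f' a| ≤ 2 * M)
    (hv : ∀ b, |v (-b, b)| ≤ M) {A B : ℝ} (hAB : 0 ≤ A + B) :
    (∫ a in (-B)..A, (f' a / 2) ^ 2) + (1 / 8) * (∫ b in (-A)..B, v (-b, b) ^ 4)
      ≤ (M ^ 2 + M ^ 4 / 8) * (A + B) := by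
  have hc := h.continuous
  have hl := h.continuous_left
  have h1 : (∫ a in (-B)..A, (f' a / 2) ^ 2) ≤ ∫ _ in (-B)..A, M ^ 2 := by
    refine integral_mono (by linarith) (Continuous.intervalIntegrable (by fun_prop) _ _)
      (Continuous.intervalIntegrable (by fun_prop) _ _) fun a => ?_
    refine sq_le_sq' ?_ ?_ <;> linarith [abs_le.1 (hf a)]
  have h2 : (∫ b in (-A)..B, v (-b, b) ^ 4) ≤ ∫ _ in (-A)..B, M ^ 4 := by
    refine integral_mono (by linarith) (Continuous.intervalIntegrable (by fun_prop) _ _)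
      (Continuous.intervalIntegrable (by fun_prop) _ _) fun b => ?_
    simpa [Even.pow_abs (by decide : Even 4)] using pow_le_pow_left₀ (abs_nonneg _) (hv b) 4
  simp only [intervalIntegral.integral_const, smul_eq_mul] at h1 h2
  linarith

/-- Growth of a solution: the cube of `v` at the apex is controlled by the energy flux through one
side of the light triangle. -/
lemma abs_pow_three_le (h : IsNullSolution v f f' g g') (hf : ∀ a, |f' a| ≤ 2 * M)
    (hg : ∀ b, |g' b| ≤ 2 * M) (hv : ∀ b, |v (-b, b)| ≤ M) {A B : ℝ} (hAB : 0 ≤ A + B) :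
    |v (A, B)| ^ 3 ≤ M ^ 3 + (27 / 2) * (M ^ 2 + M ^ 4 / 8) * (A + B) := by
  have hc := h.continuous
  have hp := h.continuous_nullDeriv
  have hE1 := (h.energy_eq hAB).le.trans (h.initial_energy_le hf hv hAB)
  have hBA : 0 ≤ B + A := by linarith
  -- The mirror identity supplies the flux of `v⁴` through the side `b = B`, the side on which `hE1`
  -- bounds `v_a²`.
  have hE2 := (h.symm.energy_eq hBA).le.trans (h.symm.initial_energy_le hg
    (fun b => by simpa using hv (-b)) hBA)
  simp only [Function.comp_apply, Prod.swap_prod_mk] at hE2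
  have hn1 : 0 ≤ ∫ b in (-A)..B, v (A, b) ^ 4 :=
    integral_nonneg (by linarith) fun b _ => by positivity
  have hn2 : 0 ≤ ∫ b in (-A)..B, nullDeriv (v ∘ Prod.swap) g' (b, A) ^ 2 :=
    integral_nonneg (by linarith) fun b _ => by positivity
  have hftc : (∫ a in (-B)..A, 3 * v (a, B) ^ 2 * nullDeriv v f' (a, B)) =
      v (A, B) ^ 3 - v (-B, B) ^ 3 := by
    refine integral_eq_sub_of_hasDerivAt_of_le (f := fun a => v (a, B) ^ 3)
      (by linarith) (Continuous.continuousOn (by fun_prop)) (fun a ha => ?_)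
      (Continuous.intervalIntegrable (by fun_prop) _ _)
    refine ((h.hasDerivAt (a := a) (b := B) (by linarith [ha.1])).pow 3).congr_deriv ?_
    norm_num
  -- With `E = (M² + M⁴ / 8) (A + B)`, the energy bounds give `∫ v⁴ ≤ 8 E` and `∫ v_a² ≤ E` on this
  -- side, so the right-hand side is at most `(3 / 2) (8 + 1) E = (27 / 2) E`.
  have hbd : |∫ a in (-B)..A, 3 * v (a, B) ^ 2 * nullDeriv v f' (a, B)| ≤
      ∫ a in (-B)..A, ((3 / 2) * v (a, B) ^ 4 + (3 / 2) * nullDeriv v f' (a, B) ^ 2) := by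
    refine (abs_integral_le_integral_abs (by linarith)).trans
      (integral_mono (by linarith) (Continuous.intervalIntegrable (by fun_prop) _ _)
        (Continuous.intervalIntegrable (by fun_prop) _ _) fun a => ?_)
    rw [abs_le]
    constructor
    · nlinarith [sq_nonneg (v (a, B) ^ 2 + nullDeriv v f' (a, B))]
    · nlinarith [sq_nonneg (v (a, B) ^ 2 - nullDeriv v f' (a, B))]
  rw [intervalIntegral.integral_add (Continuous.intervalIntegrable (by fun_prop) _ _)
    (Continuous.intervalIntegrable (by fun_prop) _ _), intervalIntegral.integral_const_mul,
    intervalIntegral.integral_const_mul, hftc] at hbd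
  have h0 : |v (-B, B) ^ 3| ≤ M ^ 3 := by
    rw [abs_pow]
    exact pow_le_pow_left₀ (abs_nonneg _) (hv B) 3
  have h3 := abs_sub_abs_le_abs_sub (v (A, B) ^ 3) (v (-B, B) ^ 3)
  rw [← abs_pow]
  linarith

end IsNullSolution

end Energy

/-! ### Return to the Cauchy problem -/

/-- Splitting `∫ u₁` over `(-B, A)` at `0` separates d'Alembert's free solution into a function of
`a` and a function of `b`. -/
lemma IsCubicWaveSolution.isNullSolution {u₀ u₁ : ℝ → ℝ} {u : ℝ → ℝ → ℝ}
    (hu : IsCubicWaveSolution u₀ u₁ u) (h₀ : ContDiff ℝ 1 u₀) (h₁ : Continuous u₁) :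
    IsNullSolution (nullForm u) (fun a => (∫ x in (0)..a, u₁ x) + u₀ a)
      (fun a => u₁ a + deriv u₀ a) (fun b => (∫ x in (-b)..0, u₁ x) + u₀ (-b))
      (fun b => u₁ (-b) - deriv u₀ (-b)) where
  continuous := hu.continuous_nullForm
  hasDerivAt_left a := ((h₁.integral_hasStrictDerivAt 0 a).hasDerivAt).add
    ((h₀.differentiable one_ne_zero) a).hasDerivAt
  continuous_left := h₁.add (h₀.continuous_deriv le_rfl)
  hasDerivAt_right b := by
    have h1 := ((h₁.integral_hasStrictDerivAt 0 (-b)).hasDerivAt).scomp b (hasDerivAt_neg b)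
    have h2 := (((h₀.differentiable one_ne_zero) (-b)).hasDerivAt).scomp b (hasDerivAt_neg b)
    have e : (fun b => (∫ x in (-b)..0, u₁ x) + u₀ (-b)) =
        fun b => -(∫ x in (0)..(-b), u₁ x) + u₀ (-b) :=
      funext fun b => by rw [intervalIntegral.integral_symm]
    rw [e]
    refine (h1.neg.add h2).congr_deriv ?_
    simp only [smul_eq_mul]
    ring
  continuous_right := (h₁.comp continuous_neg).sub
    ((h₀.continuous_deriv le_rfl).comp continuous_neg)
  duhamel A B hAB := by
    rw [hu.duhamel h₀.continuous h₁ hAB, ← integral_Ioc_eq_integral_Ioo,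
      ← intervalIntegral.integral_of_le (by linarith),
      ← intervalIntegral.integral_add_adjacent_intervals (h₁.intervalIntegrable (-B) 0)
        (h₁.intervalIntegrable 0 A)]
    ring

lemma IsCubicWaveSolution.abs_pow_three_le {u₀ u₁ : ℝ → ℝ} {u : ℝ → ℝ → ℝ} {M : ℝ}
    (hu : IsCubicWaveSolution u₀ u₁ u) (h₀ : ContDiff ℝ 1 u₀) (h₁ : Continuous u₁)
    (hM₀ : ∀ x, |u₀ x| ≤ M) (hM₀' : ∀ x, |deriv u₀ x| ≤ M) (hM₁ : ∀ x, |u₁ x| ≤ M)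
    {t : ℝ} (ht : 0 ≤ t) (x : ℝ) :
    |u t x| ^ 3 ≤ M ^ 3 + 27 * (M ^ 2 + M ^ 4 / 8) * t := by
  have hN := hu.isNullSolution h₀ h₁
  -- On the initial line the two integrals of `u₁` cancel and `u₀ (-b)` remains.
  have hinit : ∀ b, |nullForm u (-b, b)| ≤ M := by
    intro b
    rw [hN.apply_initial b, intervalIntegral.integral_symm (-b) 0]
    convert hM₀ (-b) using 2
    ring
  have h := hN.abs_pow_three_le (A := t + x) (B := t - x) (M := M)
    (fun a => (abs_add_le _ _).trans (by linarith [hM₁ a, hM₀' a]))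
    (fun b => (abs_sub _ _).trans (by linarith [hM₁ (-b), hM₀' (-b)])) hinit (by linarith)
  rw [nullForm_apply u ht] at h
  linarith

theorem proposition1 (M : ℝ) :
    ∃ C : ℝ, ∀ (u₀ u₁ : ℝ → ℝ) (u : ℝ → ℝ → ℝ),
      ContDiff ℝ 1 u₀ → Continuous u₁ →
      (∀ x, |u₀ x| ≤ M) → (∀ x, |deriv u₀ x| ≤ M) → (∀ x, |u₁ x| ≤ M) →
      IsCubicWaveSolution u₀ u₁ u →
      (∀ t x : ℝ, 1 ≤ t → |u t x| ≤ C * t ^ (1 / 3 : ℝ)) ∧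
      (∀ t x : ℝ, 0 ≤ t → t ≤ 1 → |u t x| ≤ C) := by
  -- `K` is the bound on `|u|³` at `t = 1`: the affine bound in `t` is at most `K` for `t ≤ 1` and
  -- at most `K * t` for `t ≥ 1`.
  set K : ℝ := M ^ 3 + 27 * (M ^ 2 + M ^ 4 / 8) with hK
  refine ⟨K ^ (1 / 3 : ℝ), fun u₀ u₁ u h₀ h₁ hM₀ hM₀' hM₁ hu => ?_⟩
  have hM : 0 ≤ M := (abs_nonneg _).trans (hM₀ 0)
  have hK0 : 0 ≤ K := by positivity
  have hbound : ∀ t x : ℝ, 0 ≤ t → |u t x| ^ 3 ≤ M ^ 3 + 27 * (M ^ 2 + M ^ 4 / 8) * t :=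
    fun t x ht => hu.abs_pow_three_le h₀ h₁ hM₀ hM₀' hM₁ ht x
  have hroot : ∀ y z : ℝ, 0 ≤ y → y ^ 3 ≤ z → y ≤ z ^ (1 / 3 : ℝ) := by
    intro y z hy hyz
    calc y = (y ^ 3) ^ (1 / 3 : ℝ) := by
          rw [← Real.rpow_natCast, ← Real.rpow_mul hy]; norm_num
      _ ≤ z ^ (1 / 3 : ℝ) := Real.rpow_le_rpow (by positivity) hyz (by norm_num)
  have hM3 : 0 ≤ M ^ 3 := by positivity
  have hE : 0 ≤ 27 * (M ^ 2 + M ^ 4 / 8) := by positivity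
  constructor
  · intro t x ht
    rw [← Real.mul_rpow hK0 (by linarith)]
    exact hroot _ _ (abs_nonneg _) ((hbound t x (by linarith)).trans (by nlinarith))
  · intro t x ht ht1
    exact hroot _ _ (abs_nonneg _) ((hbound t x ht).trans (by nlinarith))
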